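/- Let $G$ be a finite simple connected graph. For $u,v\in V(G)$ let $d_G(u,v)$ be their distance, $D(G)=(d_G(u,v))_{u,v}$ the distance matrix, and $Tr(G)$ the diagonal matrix whose entry at $u$ is $\sum_{v\in V(G)} d_G(u,v)$. The distance Laplacian spectral radius $\rho_L(G)$ is the largest eigenvalue of $L_D(G)=Tr(G)-D(G)$. A pendant vertex is a vertex of degree one. For $k\ge 2$ and $n\ge k+2$ let $\Re(n,k)$ be the class of connected graphs of order $n$ with exactly $k$ pendant vertices. For $t_1,t_2\ge 1$ with $t_1+t_2=k$ let $T(n,k;t_1,t_2)$ be the graph of order $n$ obtained from a path of order $\ell=n-k\ge 2$ by attaching $t_1$ pendant edges at one end of the path and $t_2$ pendant edges at the other end, and let $\mathfrak{D}(n,k)=\{T(n,k;t_1,t_2) : t_1\ge 1,\ t_2\ge 1,\ t_1+t_2=k\}$. **Theorem 2.6.** Let $k\ge 2$ and $n\ge k+2$. Then $\rho_L$ attains a maximum on $\Re(n,k)$, and every graph in $\Re(n,k)$ that attains this maximum is isomorphic to a graph in $\mathfrak{D}(n,k)$. -/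

import Mathlib

noncomputable section

namespace DistLap

/-- The transmission of a vertex: the sum of its distances to all vertices. -/
def transmission {V : Type*} [Fintype V] (G : SimpleGraph V) (u : V) : ℕ :=
  ∑ v, G.dist u v

/-- The distance matrix. -/
def distMatrix {V : Type*} (G : SimpleGraph V) : Matrix V V ℝ :=
  Matrix.of fun u v => (G.dist u v : ℝ)

/-- The distance Laplacian matrix: diagonal matrix of transmissions minus the distance matrix. -/
def distLapMatrix {V : Type*} [Fintype V] [DecidableEq V] (G : SimpleGraph V) : Matrix V V ℝ :=
  Matrix.diagonal (fun u => (transmission G u : ℝ)) - distMatrix G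

/-- The distance Laplacian spectral radius: the largest eigenvalue of the distance Laplacian
matrix (see `isGreatest_distLapRadius`). -/
def distLapRadius {V : Type*} [Fintype V] [DecidableEq V] (G : SimpleGraph V) : ℝ :=
  sSup {μ : ℝ | Module.End.HasEigenvalue (Matrix.toLin' (distLapMatrix G)) μ}

/-- On a nonempty vertex type there is a largest distance Laplacian eigenvalue, and
`distLapRadius` is it. -/
theorem isGreatest_distLapRadius {V : Type*} [Fintype V] [DecidableEq V] [Nonempty V]
    (G : SimpleGraph V) :
    IsGreatest {μ : ℝ | Module.End.HasEigenvalue (Matrix.toLin' (distLapMatrix G)) μ}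
      (distLapRadius G) := by
  have hfin : {μ : ℝ | Module.End.HasEigenvalue (Matrix.toLin' (distLapMatrix G)) μ}.Finite :=
    Module.End.finite_hasEigenvalue _
  have hne : {μ : ℝ | Module.End.HasEigenvalue (Matrix.toLin' (distLapMatrix G)) μ}.Nonempty := by
    refine ⟨0, Module.End.hasEigenvalue_of_hasEigenvector (x := fun _ => 1) ?_⟩
    refine ⟨?_, ?_⟩
    · rw [Module.End.mem_eigenspace_iff]
      ext u
      simp [distLapMatrix, distMatrix, transmission, Matrix.mulVec, dotProduct,
        Matrix.diagonal_apply]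
    · intro h
      have := congrFun h (Classical.arbitrary V)
      simp at this
  exact ⟨hne.csSup_mem hfin, fun _ hμ => le_csSup hfin.bddAbove hμ⟩

/-- The number of pendant vertices, that is, of vertices of degree one. -/
def numPendant {V : Type*} (G : SimpleGraph V) : ℕ :=
  {v : V | (G.neighborSet v).ncard = 1}.ncard

/-- The connected graphs of order `n` with exactly `k` pendant vertices. -/
def pendantClass (n k : ℕ) : Set (SimpleGraph (Fin n)) :=
  {G | G.Connected ∧ numPendant G = k}

/-- The graph obtained from the path `0, 1, …, l - 1` of order `l` by attaching `t₁` pendant edges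
at its first vertex and `t₂` pendant edges at its last vertex. -/
def doubleBroom (l t₁ t₂ : ℕ) : SimpleGraph (Fin l ⊕ (Fin t₁ ⊕ Fin t₂)) :=
  SimpleGraph.fromRel fun x y =>
    match x, y with
    | Sum.inl i, Sum.inl j => (i : ℕ) + 1 = j
    | Sum.inl i, Sum.inr (Sum.inl _) => (i : ℕ) = 0
    | Sum.inl i, Sum.inr (Sum.inr _) => (i : ℕ) + 1 = l
    | _, _ => False

/-- The graphs on `n` labelled vertices isomorphic to a double broom of order `n` with path of
order at least two and `k` attached edges in total, at least one of them at either end. -/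
def broomClass (n k : ℕ) : Set (SimpleGraph (Fin n)) :=
  {G | ∃ l t₁ t₂ : ℕ, 2 ≤ l ∧ 1 ≤ t₁ ∧ 1 ≤ t₂ ∧ t₁ + t₂ = k ∧ l + k = n ∧
    Nonempty (G ≃g doubleBroom l t₁ t₂)}

end DistLap

end

/-! The quadratic form of the distance Laplacian is half of `energy`, so the spectral radius is the
maximum of a Rayleigh quotient and cannot drop when distances grow. In particular, deleting edges
from a graph that stays connected never lowers it.

The key is a branch move in a tree (`distLapRadius_lt_reattach`). Let c have neighbours b, w₁, w₂;
cut the branch at b off c and hang it on w₁ or w₂. Distance to a fixed vertex is convex along w₁, c,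
w₂, so the two moved distances average to at least the old one. If neither move raised the radius, a
top eigenvector of the tree would give equality throughout. This forces it to be constant, which is
absurd since the radius is positive.

The maximum is taken over connected graphs with at least k pendant vertices, a class closed under
passing to spanning trees. A move can destroy only the pendant vertex it hangs the branch on. So a
maximal tree has exactly k pendant vertices, and its vertices with two non-pendant neighbours have
degree two; such a tree is a double broom. A maximal graph with a cycle would have a spanning tree
with too many pendant vertices. -/

noncomputable section

/-! ### Energy and the variational description of the radius -/

namespace DistLap

open Finset

variable {V : Type*} [Fintype V]

/-- The Dirichlet energy of `y` with respect to the pair weights `D`. -/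
def energy (D : V → V → ℝ) (y : V → ℝ) : ℝ :=
  ∑ u, ∑ v, D u v * (y u - y v) ^ 2

/-- The distances of a graph as real pair weights. -/
def distWeight {V : Type*} (G : SimpleGraph V) (u v : V) : ℝ := G.dist u v

theorem distWeight_comm {V : Type*} (G : SimpleGraph V) (u v : V) :
    distWeight G u v = distWeight G v u := by
  simp [distWeight, G.dist_comm]

theorem energy_mono {D E : V → V → ℝ} (h : ∀ u v, D u v ≤ E u v) (y : V → ℝ) :
    energy D y ≤ energy E y :=
  sum_le_sum fun u _ => sum_le_sum fun v _ => mul_le_mul_of_nonneg_right (h u v) (sq_nonneg _)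

theorem energy_eq_sum (D : V → V → ℝ) (hD : ∀ u v, D u v = D v u) (y : V → ℝ) :
    energy D y = 2 * ∑ u, y u * ∑ v, D u v * (y u - y v) := by
  have h1 : ∑ u, y u * ∑ v, D u v * (y u - y v) = ∑ u, ∑ v, y u * (D u v * (y u - y v)) := by
    simp only [mul_sum]
  have h2 : ∑ u, ∑ v, y u * (D u v * (y u - y v)) = ∑ u, ∑ v, y v * (D u v * (y v - y u)) := by
    rw [sum_comm]
    exact sum_congr rfl fun u _ => sum_congr rfl fun v _ => by rw [hD]
  rw [h1, two_mul]
  nth_rw 2 [h2]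
  simp only [energy, ← sum_add_distrib]
  exact sum_congr rfl fun u _ => sum_congr rfl fun v _ => by ring

variable [DecidableEq V]

/-- The matrix whose quadratic form is `r ∑ y² - energy D y / 2`. -/
def energyGap (D : V → V → ℝ) (r : ℝ) : Matrix V V ℝ :=
  Matrix.diagonal (fun u => r - ∑ v, D u v) + Matrix.of D

theorem energyGap_mulVec (D : V → V → ℝ) (r : ℝ) (y : V → ℝ) (u : V) :
    (energyGap D r).mulVec y u = r * y u - ∑ v, D u v * (y u - y v) := by
  simp only [energyGap, Matrix.add_mulVec, Pi.add_apply, Matrix.mulVec_diagonal, mul_sub,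
    sum_sub_distrib, ← sum_mul]
  simp only [Matrix.mulVec, dotProduct, Matrix.of_apply]
  ring

theorem dotProduct_energyGap (D : V → V → ℝ) (hD : ∀ u v, D u v = D v u) (r : ℝ) (y : V → ℝ) :
    y ⬝ᵥ (energyGap D r).mulVec y = r * ∑ u, y u ^ 2 - energy D y / 2 := by
  rw [energy_eq_sum D hD]
  rw [mul_div_cancel_left₀ _ two_ne_zero]
  simp only [dotProduct, energyGap_mulVec]
  rw [mul_sum, ← sum_sub_distrib]
  exact sum_congr rfl fun u _ => by ring

theorem isHermitian_energyGap (D : V → V → ℝ) (hD : ∀ u v, D u v = D v u) (r : ℝ) :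
    (energyGap D r).IsHermitian := by
  refine (Matrix.isHermitian_diagonal _).add ?_
  ext u v
  simp [hD u v]

theorem energyGap_distWeight (G : SimpleGraph V) (r : ℝ) :
    energyGap (distWeight G) r = r • (1 : Matrix V V ℝ) - distLapMatrix G := by
  ext u v
  by_cases h : u = v
  · simp [energyGap, distLapMatrix, distMatrix, distWeight, transmission, h]
  · simp [energyGap, distLapMatrix, distMatrix, distWeight, h]

/-- A vector attaining equality in an energy bound satisfies the eigenvector equations. -/
theorem eigen_equation {D : V → V → ℝ} (hD : ∀ u v, D u v = D v u) {r : ℝ}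
    (h : ∀ y, energy D y ≤ 2 * (r * ∑ u, y u ^ 2)) {x : V → ℝ}
    (hx : 2 * (r * ∑ u, x u ^ 2) ≤ energy D x) (u : V) :
    ∑ v, D u v * (x u - x v) = r * x u := by
  have hpsd : (energyGap D r).PosSemidef := by
    refine .of_dotProduct_mulVec_nonneg (isHermitian_energyGap D hD r) fun y => ?_
    rw [star_trivial, dotProduct_energyGap D hD]
    linarith [h y]
  have h0 : star x ⬝ᵥ (energyGap D r).mulVec x = 0 := by
    rw [star_trivial, dotProduct_energyGap D hD]
    linarith [h x]
  have := congrFun ((hpsd.dotProduct_mulVec_zero_iff x).1 h0) u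
  rw [energyGap_mulVec] at this
  simp only [Pi.zero_apply] at this
  linarith

/-- An eigenvalue μ of r - L, with r the radius, makes r - μ an eigenvalue of L. Hence r - μ ≤ r,
and r - L is positive semidefinite. -/
theorem energy_le_distLapRadius [Nonempty V] (G : SimpleGraph V) (y : V → ℝ) :
    energy (distWeight G) y ≤ 2 * (distLapRadius G * ∑ u, y u ^ 2) := by
  have hH := isHermitian_energyGap _ (distWeight_comm G) (distLapRadius G)
  have hpsd : (energyGap (distWeight G) (distLapRadius G)).PosSemidef := by
    rw [hH.posSemidef_iff_eigenvalues_nonneg]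
    intro i
    have hv := hH.mulVec_eigenvectorBasis i
    generalize hH.eigenvalues i = μ at hv ⊢
    set w : V → ℝ := (hH.eigenvectorBasis i).ofLp with hw
    have hw0 : w ≠ 0 := by
      intro h0
      apply hH.eigenvectorBasis.orthonormal.ne_zero i
      ext j
      exact congrFun h0 j
    have hev : Module.End.HasEigenvalue (Matrix.toLin' (distLapMatrix G))
        (distLapRadius G - μ) := by
      refine Module.End.hasEigenvalue_of_hasEigenvector (x := w) ⟨?_, hw0⟩
      rw [Module.End.mem_eigenspace_iff, Matrix.toLin'_apply]
      rw [energyGap_distWeight, Matrix.sub_mulVec, Matrix.smul_mulVec, Matrix.one_mulVec] at hv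
      rw [sub_smul, ← hv]
      abel
    have := (isGreatest_distLapRadius G).2 hev
    simp only [Pi.zero_apply]
    linarith
  have := hpsd.dotProduct_mulVec_nonneg y
  rw [star_trivial, dotProduct_energyGap _ (distWeight_comm G)] at this
  linarith

theorem exists_energy_eq_distLapRadius [Nonempty V] (G : SimpleGraph V) :
    ∃ x : V → ℝ, x ≠ 0 ∧ energy (distWeight G) x = 2 * (distLapRadius G * ∑ u, x u ^ 2) := by
  obtain ⟨x, hx⟩ := Module.End.HasEigenvalue.exists_hasEigenvector (isGreatest_distLapRadius G).1
  refine ⟨x, hx.2, ?_⟩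
  have h := hx.apply_eq_smul
  rw [Matrix.toLin'_apply] at h
  have h0 : (energyGap (distWeight G) (distLapRadius G)).mulVec x = 0 := by
    rw [energyGap_distWeight, Matrix.sub_mulVec, Matrix.smul_mulVec, Matrix.one_mulVec, h, sub_self]
  have := dotProduct_energyGap _ (distWeight_comm G) (distLapRadius G) x
  rw [h0, dotProduct_zero] at this
  linarith

theorem distLapRadius_anti {G H : SimpleGraph V} (hG : G.Connected) (h : G ≤ H) :
    distLapRadius H ≤ distLapRadius G := by
  have : Nonempty V := hG.nonempty
  obtain ⟨x, hx0, hx⟩ := exists_energy_eq_distLapRadius H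
  have hpos : 0 < ∑ u, x u ^ 2 := by
    obtain ⟨u, hu⟩ := Function.ne_iff.1 hx0
    exact sum_pos' (fun _ _ => sq_nonneg _) ⟨u, mem_univ _, by have : x u ≠ 0 := hu; positivity⟩
  have h1 : energy (distWeight H) x ≤ energy (distWeight G) x :=
    energy_mono (fun u v => Nat.cast_le.2 ((hG.preconnected u v).dist_anti h)) x
  have h2 := energy_le_distLapRadius G x
  rw [hx] at h1
  nlinarith

theorem distLapRadius_pos [Nontrivial V] {G : SimpleGraph V} (hG : G.Connected) :
    0 < distLapRadius G := by
  obtain ⟨a, b, hab⟩ := exists_pair_ne V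
  have h := energy_le_distLapRadius G (Pi.single a 1)
  have h1 : 0 < energy (distWeight G) (Pi.single a 1) := by
    refine sum_pos' (fun u _ => sum_nonneg fun v _ => ?_) ⟨a, mem_univ _, ?_⟩
    · exact mul_nonneg (Nat.cast_nonneg _) (sq_nonneg _)
    · refine sum_pos' (fun v _ => mul_nonneg (Nat.cast_nonneg _) (sq_nonneg _)) ⟨b, mem_univ _, ?_⟩
      have : 0 < G.dist a b := hG.pos_dist_of_ne hab
      simpa [distWeight, Pi.single_apply, hab.symm] using this
  have h2 : ∑ u, (Pi.single a (1 : ℝ) : V → ℝ) u ^ 2 = 1 := by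
    rw [sum_eq_single a] <;> simp +contextual
  rw [h2] at h
  linarith

end DistLap

end

/-! ### Distances in trees and moving a branch -/

noncomputable section

namespace DistLap

open Finset

section Tree

variable {V : Type*}

theorem le_add_dist_of_adj {H : SimpleGraph V} {f : V → ℕ}
    (hf : ∀ a b, H.Adj a b → f b ≤ f a + 1) {u v : V} (h : H.Reachable u v) :
    f v ≤ f u + H.dist u v := by
  obtain ⟨p, hp⟩ := h.exists_walk_length_eq_dist
  rw [← hp]
  clear hp h
  induction p with
  | nil => simp
  | cons hab p ih =>
    have := hf _ _ hab
    rw [SimpleGraph.Walk.length_cons]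
    omega

theorem exists_adj_dist_add_one {G : SimpleGraph V} (hG : G.Connected) {u v : V} (h : u ≠ v) :
    ∃ w, G.Adj u w ∧ G.dist w v + 1 = G.dist u v := by
  obtain ⟨p, hp⟩ := hG.exists_walk_length_eq_dist u v
  cases p with
  | nil => exact absurd rfl h
  | @cons _ w _ hw p =>
    refine ⟨w, hw, ?_⟩
    have h1 : G.dist w v ≤ p.length := G.dist_le p
    have h2 : G.dist u v ≤ G.dist u w + G.dist w v := hG.dist_triangle
    rw [SimpleGraph.dist_eq_one_iff_adj.2 hw] at h2
    rw [SimpleGraph.Walk.length_cons] at hp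
    omega

/-- In a tree, a vertex has at most one neighbour closer to a given vertex. -/
theorem eq_of_adj_of_dist_lt {T : SimpleGraph V} (hT : T.IsTree) {c u v w : V} (hv : T.Adj c v)
    (hw : T.Adj c w) (hvu : T.dist v u < T.dist c u) (hwu : T.dist w u < T.dist c u) : v = w := by
  -- Stepping to a closer neighbour starts a geodesic from c to u, and a tree has only one path from
  -- c to u.
  have key : ∀ {v}, T.Adj c v → T.dist v u < T.dist c u →
      ∃ p : T.Walk c u, p.IsPath ∧ p.snd = v := by
    intro v hv hvu
    obtain ⟨p, hp⟩ := hT.connected.exists_walk_length_eq_dist v u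
    refine ⟨.cons hv p, ?_, by simp⟩
    apply SimpleGraph.Walk.isPath_of_length_eq_dist
    have := T.dist_le (.cons hv p)
    rw [SimpleGraph.Walk.length_cons] at this ⊢
    omega
  obtain ⟨p, hp, rfl⟩ := key hv hvu
  obtain ⟨q, hq, rfl⟩ := key hw hwu
  rw [(hT.existsUnique_path c u).unique hp hq]

/-- Convexity at c: each neighbour is one step closer to u or one step farther, and at most one is
closer. -/
theorem two_mul_dist_le {T : SimpleGraph V} (hT : T.IsTree) {c v w : V} (hv : T.Adj c v)
    (hw : T.Adj c w) (hvw : v ≠ w) (u : V) : 2 * T.dist c u ≤ T.dist v u + T.dist w u := by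
  have h1 := hT.dist_eq_dist_add_one_of_adj u hv
  have h2 := hT.dist_eq_dist_add_one_of_adj u hw
  rw [T.dist_comm (u := u), T.dist_comm (u := u) (v := v)] at h1
  rw [T.dist_comm (u := u), T.dist_comm (u := u) (v := w)] at h2
  have h3 := fun h h' => hvw (eq_of_adj_of_dist_lt hT hv hw (u := u) h h')
  by_contra
  exact h3 (by omega) (by omega)

/-- The vertices on the side of `b` after deletion of the edge `bc`. -/
def side (T : SimpleGraph V) (b c : V) : Set V :=
  {v | (T.deleteEdges {s(b, c)}).Reachable b v}

/-- Replace the edge `bc` by the edge `bw`. -/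
def reattach (T : SimpleGraph V) (b c w : V) : SimpleGraph V :=
  T.deleteEdges {s(b, c)} ⊔ SimpleGraph.edge w b

theorem reattach_adj {T : SimpleGraph V} {b c w u v : V} :
    (reattach T b c w).Adj u v ↔ (T.Adj u v ∧ ¬(u = b ∧ v = c) ∧ ¬(u = c ∧ v = b)) ∨
      (u ≠ v ∧ (u = b ∧ v = w ∨ u = w ∧ v = b)) := by
  simp only [reattach, SimpleGraph.sup_adj, SimpleGraph.deleteEdges_adj, SimpleGraph.edge_adj,
    Set.mem_singleton_iff, Sym2.eq_iff]
  tauto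

theorem mem_side_self (T : SimpleGraph V) (b c : V) : b ∈ side T b c :=
  SimpleGraph.Reachable.refl _

theorem notMem_side {T : SimpleGraph V} (hT : T.IsAcyclic) {b c : V} (h : T.Adj b c) :
    c ∉ side T b c :=
  SimpleGraph.isBridge_iff.1 (SimpleGraph.isAcyclic_iff_forall_adj_isBridge.1 hT h)

theorem mem_side_iff_of_adj {T : SimpleGraph V} {b c u v : V} (h : T.Adj u v)
    (h1 : ¬(u = b ∧ v = c)) (h2 : ¬(u = c ∧ v = b)) : u ∈ side T b c ↔ v ∈ side T b c := by
  have : (T.deleteEdges {s(b, c)}).Adj u v := by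
    simp only [SimpleGraph.deleteEdges_adj, Set.mem_singleton_iff, Sym2.eq_iff]
    tauto
  exact ⟨fun hu => SimpleGraph.Reachable.trans hu this.reachable,
    fun hv => SimpleGraph.Reachable.trans hv this.symm.reachable⟩

theorem notMem_side_of_adj {T : SimpleGraph V} (hT : T.IsAcyclic) {b c w : V} (h : T.Adj b c)
    (hw : T.Adj c w) (hbw : b ≠ w) : w ∉ side T b c := by
  rw [← mem_side_iff_of_adj hw (by rintro ⟨rfl, -⟩; exact h.ne rfl)
    (by rintro ⟨-, rfl⟩; exact hbw rfl)]
  exact notMem_side hT h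

theorem reachable_or_mem_side {T : SimpleGraph V} (hT : T.Connected) (b c v : V) :
    (T.deleteEdges {s(b, c)}).Reachable v c ∨ v ∈ side T b c := by
  obtain ⟨p⟩ := hT.preconnected v b
  induction p with
  | nil => exact .inr (mem_side_self _ _ _)
  | @cons u v b' huv p ih =>
    by_cases h1 : u = b' ∧ v = c
    · exact .inr (h1.1 ▸ mem_side_self _ _ _)
    by_cases h2 : u = c ∧ v = b'
    · exact .inl (h2.1 ▸ SimpleGraph.Reachable.refl _)
    have : (T.deleteEdges {s(b', c)}).Adj u v := by
      simp only [SimpleGraph.deleteEdges_adj, Set.mem_singleton_iff, Sym2.eq_iff]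
      tauto
    rcases ih with h | h
    · exact .inl (this.reachable.trans h)
    · exact .inr ((mem_side_iff_of_adj huv h1 h2).2 h)

theorem connected_reattach {T : SimpleGraph V} (hT : T.Connected) {b c w : V}
    (hw : w ∉ side T b c) : (reattach T b c w).Connected := by
  have hle : T.deleteEdges {s(b, c)} ≤ reattach T b c w := le_sup_left
  have hwb : (reattach T b c w).Adj w b :=
    reattach_adj.2 (.inr ⟨fun h => hw (h ▸ mem_side_self _ _ _), .inr ⟨rfl, rfl⟩⟩)
  have hcb : (reattach T b c w).Reachable c b :=
    (((reachable_or_mem_side hT b c w).resolve_right hw).mono hle).symm.trans hwb.reachable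
  have key : ∀ v, (reattach T b c w).Reachable v b := fun v =>
    (reachable_or_mem_side hT b c v).elim (fun h => (h.mono hle).trans hcb)
      fun h => (SimpleGraph.Reachable.mono hle h).symm
  exact { preconnected := fun u v => (key u).trans (key v).symm, nonempty := ⟨b⟩ }

open Classical in
/-- The distances after the side of `b` has been attached at `w` by the edge `bw`. -/
def movedDist (T : SimpleGraph V) (b c w u v : V) : ℕ :=
  if u ∈ side T b c then
    if v ∈ side T b c then T.dist u v else T.dist u b + 1 + T.dist w v
  else if v ∈ side T b c then T.dist v b + 1 + T.dist w u else T.dist u v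

theorem movedDist_comm (T : SimpleGraph V) (b c w u v : V) :
    movedDist T b c w u v = movedDist T b c w v u := by
  unfold movedDist
  split_ifs <;> first | rfl | exact T.dist_comm

/-- From a fixed u the moved distance grows by at most one along each edge of H, so it bounds the
distance in H from below. Leaving H general covers both the reattached tree and, with w = c, the
tree itself. -/
theorem movedDist_le_dist {T H : SimpleGraph V} (hT : T.Connected) {b c w : V}
    (hw : w ∉ side T b c) (hH : H.Connected)
    (hadj : ∀ u v, H.Adj u v → (T.Adj u v ∧ (u ∈ side T b c ↔ v ∈ side T b c)) ∨
      (u = b ∧ v = w ∨ u = w ∧ v = b)) (u v : V) :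
    movedDist T b c w u v ≤ H.dist u v := by
  have h := le_add_dist_of_adj (H := H) (f := movedDist T b c w u) ?_ (hH.preconnected u v)
  · have : movedDist T b c w u u = 0 := by
      unfold movedDist
      split_ifs
      exact T.dist_self
      exact T.dist_self
    omega
  intro x y hxy
  have hb := mem_side_self T b c
  rcases hadj x y hxy with ⟨h1, h2⟩ | ⟨rfl, rfl⟩ | ⟨rfl, rfl⟩
  · have t : ∀ z, T.dist z y ≤ T.dist z x + 1 := fun z => by
      rw [← SimpleGraph.dist_eq_one_iff_adj.2 h1]; exact hT.dist_triangle
    have t1 := t u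
    have t2 := t w
    have t3 := t b
    rw [T.dist_comm (u := b), T.dist_comm (u := b)] at t3
    unfold movedDist
    by_cases hx : x ∈ side T b c
    · simp only [hx, h2.1 hx, if_true]; split_ifs <;> omega
    · simp only [hx, mt h2.2 hx, if_false]; split_ifs <;> omega
  · unfold movedDist
    simp only [hb, hw, if_true, if_false, SimpleGraph.dist_self]
    rw [T.dist_comm (u := y)]
    split_ifs <;> omega
  · unfold movedDist
    simp only [hb, hw, if_true, if_false, SimpleGraph.dist_self]
    rw [T.dist_comm (u := x)]
    split_ifs <;> omega

theorem movedDist_le_dist_reattach {T : SimpleGraph V} (hT : T.Connected) {b c w : V}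
    (hw : w ∉ side T b c) (u v : V) :
    movedDist T b c w u v ≤ (reattach T b c w).dist u v := by
  refine movedDist_le_dist hT hw (connected_reattach hT hw) (fun u v h => ?_) u v
  rcases reattach_adj.1 h with ⟨h1, h2, h3⟩ | ⟨-, h⟩
  · exact .inl ⟨h1, mem_side_iff_of_adj h1 h2 h3⟩
  · exact .inr h

theorem movedDist_eq_dist {T : SimpleGraph V} (hT : T.IsTree) {b c : V} (hbc : T.Adj b c)
    (u v : V) : movedDist T b c c u v = T.dist u v := by
  refine le_antisymm (movedDist_le_dist hT.connected (notMem_side hT.isAcyclic hbc)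
    hT.connected (fun u v h => ?_) u v) ?_
  · by_cases h1 : u = b ∧ v = c
    · exact .inr (.inl h1)
    by_cases h2 : u = c ∧ v = b
    · exact .inr (.inr h2)
    exact .inl ⟨h, mem_side_iff_of_adj h h1 h2⟩
  · have t : ∀ x y, T.dist x y ≤ T.dist x b + 1 + T.dist c y := fun x y => by
      rw [← SimpleGraph.dist_eq_one_iff_adj.2 hbc]
      exact hT.connected.dist_triangle.trans
        (Nat.add_le_add_right hT.connected.dist_triangle _)
    have h1 := t u v
    have h2 := t v u
    rw [T.dist_comm (u := v) (v := u)] at h2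
    unfold movedDist
    split_ifs <;> omega

/-- Only pairs separated by the edge bc change, and for these the claim is convexity of distance at
c. -/
theorem two_mul_movedDist_le {T : SimpleGraph V} (hT : T.IsTree) {b c w₁ w₂ : V}
    (h₁ : T.Adj c w₁) (h₂ : T.Adj c w₂) (h : w₁ ≠ w₂) (u v : V) :
    2 * movedDist T b c c u v ≤ movedDist T b c w₁ u v + movedDist T b c w₂ u v := by
  have t1 := two_mul_dist_le hT h₁ h₂ h u
  have t2 := two_mul_dist_le hT h₁ h₂ h v
  unfold movedDist
  split_ifs <;> omega

end Tree

variable {V : Type*} [Fintype V] [DecidableEq V]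

/-- Moving a branch of a tree from a vertex of degree at least three to one or the other of two
further neighbours increases the distance Laplacian spectral radius in at least one case. -/
theorem distLapRadius_lt_reattach {T : SimpleGraph V} (hT : T.IsTree) {b c w₁ w₂ : V}
    (hbc : T.Adj b c) (h₁ : T.Adj c w₁) (h₂ : T.Adj c w₂) (hb₁ : b ≠ w₁) (hb₂ : b ≠ w₂)
    (h₁₂ : w₁ ≠ w₂) (hr₁ : distLapRadius (reattach T b c w₁) ≤ distLapRadius T) :
    distLapRadius T < distLapRadius (reattach T b c w₂) := by
  by_contra! hr₂
  have : Nontrivial V := ⟨b, c, hbc.ne⟩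
  have hn₁ := notMem_side_of_adj hT.isAcyclic hbc h₁ hb₁
  have hn₂ := notMem_side_of_adj hT.isAcyclic hbc h₂ hb₂
  obtain ⟨x, hx0, hx⟩ := exists_energy_eq_distLapRadius T
  have hpos := distLapRadius_pos hT.connected
  set r := distLapRadius T
  have hbound : ∀ w, w ∉ side T b c → distLapRadius (reattach T b c w) ≤ r → ∀ y,
      energy (fun u v => (movedDist T b c w u v : ℝ)) y ≤ 2 * (r * ∑ u, y u ^ 2) := by
    intro w hw hr y
    refine (energy_mono (fun u v => ?_) y).trans
      ((energy_le_distLapRadius (reattach T b c w) y).trans ?_)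
    · exact Nat.cast_le.2 (movedDist_le_dist_reattach hT.connected hw u v)
    · have : 0 ≤ ∑ u, y u ^ 2 := sum_nonneg fun _ _ => sq_nonneg _
      nlinarith
  have e₁ := hbound w₁ hn₁ hr₁
  have e₂ := hbound w₂ hn₂ hr₂
  have hterm : ∀ u v, 0 ≤ ((movedDist T b c w₁ u v : ℝ) + movedDist T b c w₂ u v
      - 2 * T.dist u v) * (x u - x v) ^ 2 := fun u v => by
    have := two_mul_movedDist_le hT (b := b) h₁ h₂ h₁₂ u v
    rw [movedDist_eq_dist hT hbc] at this
    have : (2 * T.dist u v : ℝ) ≤ movedDist T b c w₁ u v + movedDist T b c w₂ u v := by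
      exact_mod_cast this
    exact mul_nonneg (by linarith) (sq_nonneg _)
  have hsum : ∑ u, ∑ v, ((movedDist T b c w₁ u v : ℝ) + movedDist T b c w₂ u v
      - 2 * T.dist u v) * (x u - x v) ^ 2 =
      energy (fun u v => (movedDist T b c w₁ u v : ℝ)) x +
      energy (fun u v => (movedDist T b c w₂ u v : ℝ)) x - 2 * energy (distWeight T) x := by
    simp only [energy, distWeight, mul_sum, ← sum_add_distrib, ← sum_sub_distrib]
    exact sum_congr rfl fun u _ => sum_congr rfl fun v _ => by ring
  have hnn := sum_nonneg fun u (_ : u ∈ univ) => sum_nonneg fun v (_ : v ∈ univ) => hterm u v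
  have hx₁ := e₁ x
  have hx₂ := e₂ x
  -- Each moved energy of x is at most 2r∑x², while their sum is at least twice that, so every
  -- nonnegative term vanishes.
  have hzero : ∀ u v, ((movedDist T b c w₁ u v : ℝ) + movedDist T b c w₂ u v
      - 2 * T.dist u v) * (x u - x v) ^ 2 = 0 := by
    intro u v
    have h0 := (sum_eq_zero_iff_of_nonneg fun u (_ : u ∈ univ) =>
      sum_nonneg fun v (_ : v ∈ univ) => hterm u v).1 (by linarith) u (mem_univ _)
    exact (sum_eq_zero_iff_of_nonneg fun v (_ : v ∈ univ) => hterm u v).1 h0 v (mem_univ _)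
  have hc := notMem_side hT.isAcyclic hbc
  -- For u in the branch, both moves lengthen the distance to c by one, so the coefficient of (x u -
  -- x c)² is 2.
  have hside : ∀ u ∈ side T b c, x u = x c := by
    intro u hu
    have h0 := hzero u c
    rw [← movedDist_eq_dist hT hbc] at h0
    simp only [movedDist, hu, hc, if_true, if_false, SimpleGraph.dist_self,
      SimpleGraph.dist_eq_one_iff_adj.2 h₁.symm, SimpleGraph.dist_eq_one_iff_adj.2 h₂.symm] at h0
    push_cast at h0
    have : (x u - x c) ^ 2 = 0 := by linarith
    exact sub_eq_zero.1 (pow_eq_zero_iff two_ne_zero |>.1 this)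
  have hconst : ∀ u, x u = x c := by
    intro u
    by_cases hu : u ∈ side T b c
    · exact hside u hu
    -- Equality makes x satisfy the eigenvector equations for the old and the moved distances with
    -- the same r. In their difference only v in the branch survive, each contributing the same
    -- amount because x equals x c there.
    have q₀ := eigen_equation (distWeight_comm T) (energy_le_distLapRadius T) hx.ge u
    have q₁ := eigen_equation (D := fun u v => (movedDist T b c w₁ u v : ℝ))
      (fun u v => by rw [movedDist_comm]) e₁ (x := x) (by linarith) u
    have hdiff : ∑ v, ((movedDist T b c w₁ u v : ℝ) - T.dist u v) * (x u - x v) = 0 := by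
      simp only [sub_mul _ _ (x u - x _), sum_sub_distrib]
      rw [q₁, ← q₀]
      simp [distWeight]
    classical
    have hdiff' : ∑ v, (if v ∈ side T b c then
        ((T.dist w₁ u : ℝ) - T.dist c u) * (x u - x c) else 0) = 0 := by
      refine Eq.trans ?_ hdiff
      refine sum_congr rfl fun v _ => ?_
      rw [← movedDist_eq_dist hT hbc u v]
      by_cases hv : v ∈ side T b c
      · simp only [movedDist, hu, hv, if_true, if_false, hside v hv]
        push_cast
        ring
      · simp [movedDist, hu, hv]
    rw [← sum_filter, sum_const, smul_eq_zero] at hdiff'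
    rcases hdiff' with h | h
    · exact absurd (card_eq_zero.1 h) (ne_empty_of_mem
        (mem_filter.2 ⟨mem_univ b, mem_side_self T b c⟩))
    rcases mul_eq_zero.1 h with h | h
    -- Adjacent vertices of a tree are never equidistant from u.
    · have h3 := hT.dist_ne_of_adj u h₁
      rw [T.dist_comm, T.dist_comm (v := w₁)] at h3
      exact absurd (Nat.cast_injective (sub_eq_zero.1 h)).symm h3
    · exact sub_eq_zero.1 h
  have hE : energy (distWeight T) x = 0 := by
    simp [energy, hconst]
  rw [hE] at hx
  have hs : 0 < ∑ u, x u ^ 2 := by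
    obtain ⟨u, hu⟩ := Function.ne_iff.1 hx0
    exact sum_pos' (fun _ _ => sq_nonneg _) ⟨u, mem_univ _, by have : x u ≠ 0 := hu; positivity⟩
  have := mul_pos hpos hs
  linarith

end DistLap

end

/-! ### Counting pendant vertices -/

noncomputable section

namespace DistLap

open Finset

section Pendant

variable {V : Type*}

/-- The set of pendant vertices. -/
def pendants (G : SimpleGraph V) : Set V := {v | (G.neighborSet v).ncard = 1}

theorem mem_pendants_iff {G : SimpleGraph V} {v : V} :
    v ∈ pendants G ↔ ∃ w, ∀ u, G.Adj v u ↔ u = w := by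
  simp [pendants, Set.ncard_eq_one, Set.ext_iff]

theorem eq_of_mem_pendants {G : SimpleGraph V} {v u w : V} (h : v ∈ pendants G) (hu : G.Adj v u)
    (hw : G.Adj v w) : u = w := by
  obtain ⟨z, hz⟩ := mem_pendants_iff.1 h
  rw [(hz u).1 hu, (hz w).1 hw]

theorem notMem_pendants {G : SimpleGraph V} {v u w : V} (hu : G.Adj v u) (hw : G.Adj v w)
    (h : u ≠ w) : v ∉ pendants G :=
  fun hv => h (eq_of_mem_pendants hv hu hw)

/-- Connectedness leaves every vertex a neighbour, so a vertex of degree one keeps its only edge. -/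
theorem pendants_anti [Nontrivial V] {T G : SimpleGraph V} (hT : T.Connected) (h : T ≤ G) :
    pendants G ⊆ pendants T := by
  intro v hv
  obtain ⟨u, hu⟩ := hT.preconnected.exists_adj_of_nontrivial v
  exact mem_pendants_iff.2 ⟨u, fun w =>
    ⟨fun hw => eq_of_mem_pendants hv (h hw) (h hu), fun e => e ▸ hu⟩⟩

/-- Only b, c and w change neighbours, and b merely exchanges c for w. -/
theorem mem_pendants_reattach {T : SimpleGraph V} {b c w p : V} (hbc : T.Adj b c)
    (hc : c ∉ pendants T) (hbw : b ≠ w) (hp : p ∈ pendants T) (hpw : p ≠ w) :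
    p ∈ pendants (reattach T b c w) := by
  have hpc : p ≠ c := fun h => hc (h ▸ hp)
  obtain ⟨q, hq⟩ := mem_pendants_iff.1 hp
  by_cases hpb : p = b
  · subst hpb
    have hcq := (hq c).1 hbc
    subst hcq
    refine mem_pendants_iff.2 ⟨w, fun u => ?_⟩
    rw [reattach_adj, hq]
    grind
  · refine mem_pendants_iff.2 ⟨q, fun u => ?_⟩
    rw [reattach_adj, hq]
    grind

variable [Finite V]

theorem numPendant_le_of_subset {G H : SimpleGraph V} (h : pendants G ⊆ pendants H) :
    numPendant G ≤ numPendant H :=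
  Set.ncard_le_ncard h (Set.toFinite _)

theorem numPendant_le_of_diff_subset {G H : SimpleGraph V} {w : V}
    (h : pendants G \ {w} ⊆ pendants H) : numPendant G ≤ numPendant H + 1 := by
  have h1 := Set.le_ncard_sdiff {w} (pendants G)
  have h2 := Set.ncard_le_ncard h (Set.toFinite _)
  rw [Set.ncard_singleton] at h1
  change (pendants G).ncard ≤ (pendants H).ncard + 1
  omega

end Pendant

/-- With all degrees at most two, the degree sum 2(|V| - 1) would be at most 2|V| minus the number
of pendant vertices. -/
theorem exists_three_neighbors {V : Type*} [Fintype V] {T : SimpleGraph V} (hT : T.IsTree)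
    (h : 3 ≤ numPendant T) :
    ∃ c b w₁ w₂, T.Adj c b ∧ T.Adj c w₁ ∧ T.Adj c w₂ ∧ b ≠ w₁ ∧ b ≠ w₂ ∧ w₁ ≠ w₂ := by
  classical
  by_contra! hcon
  have hdeg : ∀ v, T.degree v = (T.neighborSet v).ncard := fun v => by
    rw [← SimpleGraph.card_neighborSet_eq_degree, Set.ncard_eq_toFinset_card', Set.toFinset_card]
  have hle : ∀ v, T.degree v + (if v ∈ pendants T then 1 else 0) ≤ 2 := by
    intro v
    split_ifs with hv
    · rw [hdeg, show (T.neighborSet v).ncard = 1 from hv]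
    · rw [hdeg]
      by_contra! h2
      obtain ⟨a, b, c, ha, hb, hc, hab, hac, hbc⟩ := (Set.two_lt_ncard_iff (Set.toFinite _)).1 h2
      exact hbc (hcon v a b c ha hb hc hab hac)
  have hsum := sum_le_sum fun v (_ : v ∈ univ) => hle v
  rw [sum_add_distrib, T.sum_degrees_eq_twice_card_edges, ← sum_filter, sum_const, sum_const,
    card_univ] at hsum
  have hedge := hT.card_edgeFinset
  have hL : numPendant T = #{v | v ∈ pendants T} := by
    rw [numPendant, Set.ncard_eq_toFinset_card']
    congr 1
    ext v
    simp [pendants]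
  simp only [smul_eq_mul] at hsum
  omega

/-! ### Extremal graphs are trees with exactly k pendant vertices -/

section Extremal

variable {V : Type*} [Fintype V] [DecidableEq V]

/-- `T` maximizes the distance Laplacian spectral radius among the connected graphs with at least
`k` pendant vertices. -/
structure IsExtremal (k : ℕ) (T : SimpleGraph V) : Prop where
  connected : T.Connected
  le_numPendant : k ≤ numPendant T
  radius_le : ∀ H : SimpleGraph V, H.Connected → k ≤ numPendant H →
    distLapRadius H ≤ distLapRadius T

variable {k : ℕ} {T G : SimpleGraph V}

theorem IsExtremal.of_le [Nontrivial V] (hG : IsExtremal k G) (hT : T.Connected) (h : T ≤ G) :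
    IsExtremal k T where
  connected := hT
  le_numPendant := hG.le_numPendant.trans (numPendant_le_of_subset (pendants_anti hT h))
  radius_le H hH hk := (hG.radius_le H hH hk).trans (distLapRadius_anti hT h)

theorem IsExtremal.not_three_neighbors (hT : IsExtremal k T) (ht : T.IsTree) {c b w₁ w₂ : V}
    (hb : T.Adj c b) (h₁ : T.Adj c w₁) (h₂ : T.Adj c w₂) (hb₁ : b ≠ w₁) (hb₂ : b ≠ w₂)
    (h₁₂ : w₁ ≠ w₂) (hk₁ : k ≤ numPendant (reattach T b c w₁))
    (hk₂ : k ≤ numPendant (reattach T b c w₂)) : False := by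
  have hc : ∀ {w}, T.Adj c w → b ≠ w → (reattach T b c w).Connected := fun hw hbw =>
    connected_reattach ht.connected (notMem_side_of_adj ht.isAcyclic hb.symm hw hbw)
  exact (distLapRadius_lt_reattach ht hb.symm h₁ h₂ hb₁ hb₂ h₁₂
    (hT.radius_le _ (hc h₁ hb₁) hk₁)).not_ge (hT.radius_le _ (hc h₂ hb₂) hk₂)

/-- In an extremal tree a vertex with two non-pendant neighbours has degree two. -/
theorem IsExtremal.eq_or_eq_of_adj (hT : IsExtremal k T) (ht : T.IsTree) {c b w₁ w₂ : V}
    (h₁ : T.Adj c w₁) (h₂ : T.Adj c w₂) (h₁₂ : w₁ ≠ w₂) (hw₁ : w₁ ∉ pendants T)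
    (hw₂ : w₂ ∉ pendants T) (hb : T.Adj c b) : b = w₁ ∨ b = w₂ := by
  by_contra! h
  have hc := notMem_pendants h₁ h₂ h₁₂
  have hk : ∀ {w}, b ≠ w → w ∉ pendants T → k ≤ numPendant (reattach T b c w) :=
    fun hbw hw => hT.le_numPendant.trans (numPendant_le_of_subset fun p hp =>
      mem_pendants_reattach hb.symm hc hbw hp fun e => hw (e ▸ hp))
  exact hT.not_three_neighbors ht hb h₁ h₂ h.1 h.2 h₁₂ (hk h.1 hw₁) (hk h.2 hw₂)

/-- With a pendant vertex to spare, both branch moves stay admissible, as each loses at most one. -/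
theorem IsExtremal.numPendant_eq_of_isTree (hk2 : 2 ≤ k) (hT : IsExtremal k T) (ht : T.IsTree) :
    numPendant T = k := by
  refine le_antisymm ?_ hT.le_numPendant
  by_contra! hlt
  obtain ⟨c, b, w₁, w₂, hb, h₁, h₂, hb₁, hb₂, h₁₂⟩ := exists_three_neighbors ht (by omega)
  have hc := notMem_pendants h₁ h₂ h₁₂
  have hk : ∀ {w}, b ≠ w → k ≤ numPendant (reattach T b c w) := fun {w} hbw => by
    have := numPendant_le_of_diff_subset (G := T) (H := reattach T b c w) (w := w) fun p hp =>
      mem_pendants_reattach hb.symm hc hbw hp.1 hp.2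
    omega
  exact hT.not_three_neighbors ht hb h₁ h₂ hb₁ hb₂ h₁₂ (hk hb₁) (hk hb₂)

theorem IsExtremal.numPendant_eq [Nontrivial V] (hk2 : 2 ≤ k) (hG : IsExtremal k G) :
    numPendant G = k := by
  obtain ⟨T, hTG, hT⟩ := hG.connected.exists_isTree_le
  have h := (hG.of_le hT.connected hTG).numPendant_eq_of_isTree hk2 hT
  exact le_antisymm (h ▸ numPendant_le_of_subset (pendants_anti hT.connected hTG)) hG.le_numPendant

/-- Exchanging an edge of a spanning tree for a missing edge of G would give another extremal
spanning tree with one more pendant vertex. -/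
theorem IsExtremal.isTree [Nontrivial V] (hk2 : 2 ≤ k) (hG : IsExtremal k G) : G.IsTree := by
  obtain ⟨T, hTG, hT⟩ := hG.connected.exists_isTree_le
  have hext := hG.of_le hT.connected hTG
  have hpend : pendants G = pendants T := by
    refine Set.eq_of_subset_of_ncard_le (pendants_anti hT.connected hTG) ?_ (Set.toFinite _)
    exact (hext.numPendant_eq hk2).trans_le hG.le_numPendant
  suffices G = T by rwa [this]
  refine le_antisymm (fun u v huv => ?_) hTG
  by_contra hnot
  -- A vertex pendant in both G and T has its only G-edge in T.
  have hnp : ∀ {u v}, G.Adj u v → ¬ T.Adj u v → u ∉ pendants T := by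
    intro u v huv hnot hu
    obtain ⟨w, hw⟩ := hT.connected.preconnected.exists_adj_of_nontrivial u
    exact hnot (eq_of_mem_pendants (hpend ▸ hu) huv (hTG hw) ▸ hw)
  have hu := hnp huv hnot
  have hv := hnp huv.symm fun h => hnot h.symm
  obtain ⟨a, hua, hav⟩ := exists_adj_dist_add_one hT.connected huv.ne
  have hav' : a ≠ v := fun h => hnot (h ▸ hua)
  obtain ⟨a', haa', ha'v⟩ := exists_adj_dist_add_one hT.connected hav'
  have hua' : u ≠ a' := by rintro rfl; omega
  have ha' : a' ∉ pendants T := by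
    by_cases h : a' = v
    · rwa [h]
    obtain ⟨a'', h1, h2⟩ := exists_adj_dist_add_one hT.connected h
    exact notMem_pendants haa'.symm h1 (by rintro rfl; omega)
  have ha := notMem_pendants hua.symm haa' hua'
  have hdeg := fun b => hext.eq_or_eq_of_adj hT (b := b) hua.symm haa' hua' hu ha'
  -- Otherwise the path from a to v would pass through u, although a is closer to v than u is.
  have hside : v ∉ side T u a := by
    intro hmem
    have h := movedDist_eq_dist hT hua a v
    simp only [movedDist, hmem, notMem_side hT.isAcyclic hua, if_true, if_false,
      SimpleGraph.dist_self] at h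
    rw [T.dist_comm (u := v)] at h
    omega
  have hle : reattach T u a v ≤ G := by
    intro x y hxy
    rcases reattach_adj.1 hxy with h | ⟨-, ⟨rfl, rfl⟩ | ⟨rfl, rfl⟩⟩
    · exact hTG h.1
    · exact huv
    · exact huv.symm
  have hH := hG.of_le (connected_reattach hT.connected hside) hle
  -- The vertex a has degree two in T; losing u leaves it only a', so it becomes pendant.
  have hlt : pendants T ⊂ pendants (reattach T u a v) := by
    refine (Set.ssubset_iff_of_subset fun p hp =>
      mem_pendants_reattach hua ha huv.ne hp fun e => hv (e ▸ hp)).2 ⟨a, ?_, ha⟩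
    refine mem_pendants_iff.2 ⟨a', fun y => ?_⟩
    rw [reattach_adj]
    have := hua.ne
    have := hdeg y
    grind
  have := Set.ncard_lt_ncard hlt (Set.toFinite _)
  have h1 : (pendants T).ncard = k := hext.numPendant_eq hk2
  have h2 : (pendants (reattach T u a v)).ncard = k := hH.numPendant_eq hk2
  omega

/-- A star has enough pendant vertices, so the finite class of candidates is nonempty. -/
theorem exists_isExtremal [Nonempty V] (hk : k + 1 ≤ Fintype.card V) :
    ∃ G : SimpleGraph V, IsExtremal k G := by
  obtain ⟨r⟩ := ‹Nonempty V›
  have hstar : k ≤ numPendant (SimpleGraph.starGraph r) := by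
    have hsub : ({r}ᶜ : Set V) ⊆ pendants (SimpleGraph.starGraph r) := by
      intro v hv
      refine mem_pendants_iff.2 ⟨r, fun u => ?_⟩
      have : v ≠ r := hv
      rw [SimpleGraph.starGraph_adj]
      grind
    have h1 := Set.ncard_le_ncard hsub (Set.toFinite _)
    rw [Set.ncard_compl, Set.ncard_singleton, Nat.card_eq_fintype_card] at h1
    have h2 : numPendant (SimpleGraph.starGraph r) = (pendants (SimpleGraph.starGraph r)).ncard := rfl
    omega
  obtain ⟨G, hG, hmax⟩ := Set.exists_max_image
    {G : SimpleGraph V | G.Connected ∧ k ≤ numPendant G} distLapRadius (Set.toFinite _)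
    ⟨_, SimpleGraph.connected_starGraph r, hstar⟩
  exact ⟨G, hG.1, hG.2, fun H hH hk => hmax H ⟨hH, hk⟩⟩

end Extremal

end DistLap

end

/-! ### Recognizing double brooms -/

noncomputable section

namespace DistLap

open Finset

theorem exists_geodesic {V : Type*} {G : SimpleGraph V} (hG : G.Connected) (p q : V) :
    ∃ z : ℕ → V, (∀ i < G.dist p q, G.Adj (z i) (z (i + 1))) ∧
      (∀ i ≤ G.dist p q, G.dist p (z i) = i) ∧ z 0 = p ∧ z (G.dist p q) = q := by
  obtain ⟨W, hW⟩ := hG.exists_walk_length_eq_dist p q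
  refine ⟨W.getVert, fun i hi => W.adj_getVert_succ (hW ▸ hi), fun i hi => ?_,
    W.getVert_zero, hW ▸ W.getVert_length⟩
  have h1 := G.dist_le (W.take i)
  have h2 := G.dist_le (W.drop i)
  have h3 : G.dist p q ≤ G.dist p (W.getVert i) + G.dist (W.getVert i) q := hG.dist_triangle
  rw [SimpleGraph.Walk.take_length] at h1
  rw [SimpleGraph.Walk.drop_length] at h2
  omega

theorem doubleBroom_adj_inl_inl {l t₁ t₂ : ℕ} {i j : Fin l} :
    (doubleBroom l t₁ t₂).Adj (.inl i) (.inl j) ↔ (i : ℕ) + 1 = j ∨ (j : ℕ) + 1 = i := by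
  simp only [doubleBroom, SimpleGraph.fromRel_adj, ne_eq, Sum.inl.injEq, and_iff_right_iff_imp]
  rintro h rfl
  omega

theorem doubleBroom_adj_inl_inr_inl {l t₁ t₂ : ℕ} {i : Fin l} {a : Fin t₁} :
    (doubleBroom l t₁ t₂).Adj (.inl i) (.inr (.inl a)) ↔ (i : ℕ) = 0 := by
  simp [doubleBroom]

theorem doubleBroom_adj_inl_inr_inr {l t₁ t₂ : ℕ} {i : Fin l} {a : Fin t₂} :
    (doubleBroom l t₁ t₂).Adj (.inl i) (.inr (.inr a)) ↔ (i : ℕ) + 1 = l := by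
  simp [doubleBroom]

theorem not_doubleBroom_adj_inr_inr {l t₁ t₂ : ℕ} {a b : Fin t₁ ⊕ Fin t₂} :
    ¬ (doubleBroom l t₁ t₂).Adj (.inr a) (.inr b) := by
  simp [doubleBroom]

/-- A bijection from the vertices of a double broom that matches the path with a path and the
two groups of attached vertices with pendant vertices at its ends is an isomorphism. -/
theorem nonempty_iso_doubleBroom {V : Type*} {T : SimpleGraph V} {l t₁ t₂ : ℕ}
    (e : Fin l ⊕ (Fin t₁ ⊕ Fin t₂) ≃ V)
    (hpath : ∀ i j, T.Adj (e (.inl i)) (e (.inl j)) ↔ (i : ℕ) + 1 = j ∨ (j : ℕ) + 1 = i)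
    (hleft : ∀ i a, T.Adj (e (.inl i)) (e (.inr (.inl a))) ↔ (i : ℕ) = 0)
    (hright : ∀ i a, T.Adj (e (.inl i)) (e (.inr (.inr a))) ↔ (i : ℕ) + 1 = l)
    (hpend : ∀ a b, ¬ T.Adj (e (.inr a)) (e (.inr b))) :
    Nonempty (T ≃g doubleBroom l t₁ t₂) := by
  refine ⟨SimpleGraph.Iso.symm ⟨e, fun {x y} => ?_⟩⟩
  rcases x with i | a | a <;> rcases y with j | b | b
  · rw [hpath, doubleBroom_adj_inl_inl]
  · rw [hleft, doubleBroom_adj_inl_inr_inl]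
  · rw [hright, doubleBroom_adj_inl_inr_inr]
  · rw [T.adj_comm, (doubleBroom l t₁ t₂).adj_comm, hleft, doubleBroom_adj_inl_inr_inl]
  · exact iff_of_false (hpend _ _) not_doubleBroom_adj_inr_inr
  · exact iff_of_false (hpend _ _) not_doubleBroom_adj_inr_inr
  · rw [T.adj_comm, (doubleBroom l t₁ t₂).adj_comm, hright, doubleBroom_adj_inl_inr_inr]
  · exact iff_of_false (hpend _ _) not_doubleBroom_adj_inr_inr
  · exact iff_of_false (hpend _ _) not_doubleBroom_adj_inr_inr

/-- In a tree, a vertex farthest from `p` is pendant. -/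
theorem mem_pendants_of_forall_dist_le {V : Type*} {T : SimpleGraph V} (hT : T.IsTree) {p v : V}
    (hvp : v ≠ p) (hmax : ∀ u, T.dist u p ≤ T.dist v p) : v ∈ pendants T := by
  obtain ⟨w, hvw, hw⟩ := exists_adj_dist_add_one hT.connected hvp
  refine mem_pendants_iff.2 ⟨w, fun u => ⟨fun hu => ?_, fun h => h ▸ hvw⟩⟩
  -- No neighbour of v is farther from p, and none is equidistant, so all are closer; only one can
  -- be.
  refine eq_of_adj_of_dist_lt hT hu hvw (u := p) ((hmax u).lt_of_ne fun h => ?_) (by omega)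
  apply hT.dist_ne_of_adj p hu
  rw [T.dist_comm, ← h, T.dist_comm]

/-- A tree with at least two non-pendant vertices, in which every vertex with two non-pendant
neighbours has degree two, is a double broom. -/
theorem exists_iso_doubleBroom {V : Type*} [Finite V] {T : SimpleGraph V} (hT : T.IsTree)
    (hdeg : ∀ ⦃c b w₁ w₂⦄, T.Adj c w₁ → T.Adj c w₂ → w₁ ≠ w₂ → w₁ ∉ pendants T →
      w₂ ∉ pendants T → T.Adj c b → b = w₁ ∨ b = w₂)
    (hne : (pendants T).Nonempty) {x y : V} (hx : x ∉ pendants T) (hy : y ∉ pendants T)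
    (hxy : x ≠ y) :
    ∃ l t₁ t₂ : ℕ, 2 ≤ l ∧ 1 ≤ t₁ ∧ 1 ≤ t₂ ∧ t₁ + t₂ = numPendant T ∧
      l + numPendant T = Nat.card V ∧ Nonempty (T ≃g doubleBroom l t₁ t₂) := by
  obtain ⟨p, hp⟩ := hne
  have : Nonempty V := ⟨p⟩
  obtain ⟨q, hq⟩ := Finite.exists_max fun v => T.dist p v
  obtain ⟨z, hadj, hdist, hz0, hzm⟩ := exists_geodesic hT.connected p q
  set m := T.dist p q with hm
  have hinj : ∀ i ≤ m, ∀ j ≤ m, z i = z j → i = j := fun i hi j hj h => by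
    rw [← hdist i hi, ← hdist j hj, h]
  have hpar : ∀ v, v ≠ p → ∃ w, T.Adj v w ∧ T.dist p w + 1 = T.dist p v := fun v hv => by
    obtain ⟨w, hw⟩ := exists_adj_dist_add_one hT.connected hv
    rw [T.dist_comm, T.dist_comm (u := v)] at hw
    exact ⟨w, hw⟩
  have hfar : ∀ v, v ≠ p → T.dist p v = m → v ∈ pendants T := fun v hv hvm =>
    mem_pendants_of_forall_dist_le hT hv fun u => by
      rw [T.dist_comm, T.dist_comm (u := v), hvm]
      exact hq u
  have hznp : ∀ i, 0 < i → i < m → z i ∉ pendants T := by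
    intro i h0 hi
    obtain ⟨j, rfl⟩ := Nat.exists_eq_succ_of_ne_zero h0.ne'
    refine notMem_pendants (hadj j (by omega)).symm (hadj (j + 1) hi) fun h => ?_
    have := hinj _ (by omega) _ (by omega) h
    omega
  -- The non-pendant vertices all lie on the geodesic from p to q: at the first departure, a
  -- geodesic vertex would have two non-pendant neighbours and a third neighbour behind it.
  have hspine : ∀ j v, v ∉ pendants T → T.dist p v = j + 1 → v = z (j + 1) ∧ j + 1 < m := by
    intro j
    induction j with
    | zero =>
      intro v hv hvj
      have hvp : v ≠ p := fun h => hv (h ▸ hp)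
      have hlt : 1 < m := lt_of_le_of_ne (hvj.symm.le.trans (hq v)) fun h =>
        hv (hfar v hvp (by omega))
      refine ⟨eq_of_mem_pendants hp (SimpleGraph.dist_eq_one_iff_adj.1 hvj) ?_, hlt⟩
      have := hadj 0 (by omega)
      rwa [hz0] at this
    | succ j ih =>
      intro v hv hvj
      have hvp : v ≠ p := fun h => hv (h ▸ hp)
      have hlt : j + 1 + 1 < m := lt_of_le_of_ne (hvj.symm.le.trans (hq v)) fun h =>
        hv (hfar v hvp (by omega))
      refine ⟨?_, hlt⟩
      obtain ⟨u, hvu, hu⟩ := hpar v hvp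
      have hup : u ≠ p := by rintro rfl; rw [SimpleGraph.dist_self] at hu; omega
      obtain ⟨w, huw, hw⟩ := hpar u hup
      have hunp : u ∉ pendants T := notMem_pendants hvu.symm huw (by rintro rfl; omega)
      have huz := (ih u hunp (by omega)).1
      subst huz
      by_contra hne
      rcases hdeg hvu.symm (hadj (j + 1) (by omega)) hne hv (hznp _ (by omega) hlt)
        (hadj j (by omega)).symm with h | h
      · have := hdist j (by omega)
        rw [h] at this
        omega
      · have := hinj _ (by omega) _ (by omega) h
        omega
  have hdpos : ∀ {v}, v ∉ pendants T → ∃ j, T.dist p v = j + 1 := fun {v} hv =>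
    Nat.exists_eq_succ_of_ne_zero
      (hT.connected.pos_dist_of_ne (by rintro rfl; exact hv hp)).ne'
  have hm3 : 3 ≤ m := by
    obtain ⟨i, hi⟩ := hdpos hx
    obtain ⟨j, hj⟩ := hdpos hy
    obtain ⟨h1, h2⟩ := hspine i x hx hi
    obtain ⟨h3, h4⟩ := hspine j y hy hj
    have : i ≠ j := by rintro rfl; exact hxy (h1.trans h3.symm)
    omega
  have hpz : T.Adj (z 1) p := by
    have := hadj 0 (by omega)
    rw [hz0] at this
    exact this.symm
  have hqz : T.Adj (z (m - 1)) q := by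
    have := hadj (m - 1) (by omega)
    rwa [Nat.sub_add_cancel (by omega), hzm] at this
  have hqp : q ∈ pendants T := hfar q (by rintro rfl; rw [SimpleGraph.dist_self] at hm; omega) rfl
  -- A pendant vertex hanging on z i with 1 < i < m - 1 would be a third neighbour beside two
  -- non-pendant ones.
  have hleaf : ∀ v ∈ pendants T, T.Adj (z 1) v ∨ T.Adj (z (m - 1)) v := by
    intro v hv
    by_cases hvp : v = p
    · exact .inl (hvp ▸ hpz)
    obtain ⟨u, hvu, hu⟩ := hpar v hvp
    by_cases hup : u = p
    · subst hup
      have := eq_of_mem_pendants hp hvu.symm hpz.symm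
      exact absurd (this ▸ hv) (hznp 1 (by omega) (by omega))
    obtain ⟨w, huw, hw⟩ := hpar u hup
    have hunp : u ∉ pendants T := notMem_pendants hvu.symm huw (by rintro rfl; omega)
    obtain ⟨j, hj⟩ := hdpos hunp
    obtain ⟨rfl, hjm⟩ := hspine j u hunp hj
    by_cases h1 : j = 0
    · subst h1
      exact .inl hvu.symm
    by_cases h2 : j + 1 = m - 1
    · rw [← h2]
      exact .inr hvu.symm
    obtain ⟨i, rfl⟩ := Nat.exists_eq_succ_of_ne_zero h1
    have hi := hznp (i + 1) (by omega) (by omega)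
    have hi' := hznp (i + 1 + 1 + 1) (by omega) (by omega)
    rcases hdeg (hadj (i + 1) (by omega)).symm (hadj (i + 1 + 1) (by omega))
      (fun h => by have := hinj _ (by omega) _ (by omega) h; omega) hi hi' hvu.symm with h | h
    · exact absurd (h ▸ hv) hi
    · exact absurd (h ▸ hv) hi'
  set A : Set V := {v | v ∈ pendants T ∧ T.Adj (z 1) v} with hA
  set B : Set V := {v | v ∈ pendants T ∧ T.Adj (z (m - 1)) v} with hB
  have hAB : Disjoint A B := by
    rw [Set.disjoint_left]
    rintro v ⟨hv, h1⟩ ⟨-, h2⟩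
    have := hinj _ (by omega) _ (by omega) (eq_of_mem_pendants hv h1.symm h2.symm)
    omega
  have hunion : A ∪ B = pendants T := by
    ext v
    refine ⟨fun h => h.elim And.left And.left, fun h => ?_⟩
    exact (hleaf v h).elim (fun h' => .inl ⟨h, h'⟩) fun h' => .inr ⟨h, h'⟩
  have hcard : A.ncard + B.ncard = numPendant T := by
    rw [← Set.ncard_union_eq hAB, hunion]
    rfl
  let e₁ : Fin A.ncard ≃ A := (Finite.equivFinOfCardEq rfl).symm
  let e₂ : Fin B.ncard ≃ B := (Finite.equivFinOfCardEq rfl).symm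
  -- The ends p = z 0 and q = z m are pendant, so the broom's path is z 1, …, z (m - 1); hence the
  -- shift by one.
  let f : Fin (m - 1) ⊕ (Fin A.ncard ⊕ Fin B.ncard) → V :=
    Sum.elim (fun i => z (i + 1)) (Sum.elim (fun a => e₁ a) fun b => e₂ b)
  have hfl : ∀ i : Fin (m - 1), z (i + 1) ∉ pendants T := fun i => hznp _ (by omega) (by omega)
  have hfr : ∀ a, f (.inr a) ∈ pendants T := by
    rintro (a | a)
    · exact (e₁ a).2.1
    · exact (e₂ a).2.1
  have hf : Function.Bijective f := by
    constructor
    · refine Function.Injective.sumElim (fun i j h => ?_) (Function.Injective.sumElim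
        (Subtype.val_injective.comp e₁.injective) (Subtype.val_injective.comp e₂.injective)
        fun a b => ?_) fun i a h => hfl i ?_
      · have := hinj _ (by omega) _ (by omega) h
        exact Fin.ext (by omega)
      · exact hAB.ne_of_mem (e₁ a).2 (e₂ b).2
      · rw [h]
        exact hfr a
    · intro v
      by_cases hv : v ∈ pendants T
      · rw [← hunion] at hv
        rcases hv with hv | hv
        · exact ⟨.inr (.inl (e₁.symm ⟨v, hv⟩)), by simp [f]⟩
        · exact ⟨.inr (.inr (e₂.symm ⟨v, hv⟩)), by simp [f]⟩
      · obtain ⟨j, hj⟩ := hdpos hv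
        obtain ⟨h1, h2⟩ := hspine j v hv hj
        exact ⟨.inl ⟨j, by omega⟩, h1.symm⟩
  refine ⟨m - 1, A.ncard, B.ncard, by omega, (Set.ncard_pos (Set.toFinite _)).2 ⟨p, hp, hpz⟩,
    (Set.ncard_pos (Set.toFinite _)).2 ⟨q, hqp, hqz⟩, hcard, ?_,
    nonempty_iso_doubleBroom (Equiv.ofBijective f hf) ?_ ?_ ?_ ?_⟩
  · rw [← hcard, ← Nat.card_congr (Equiv.ofBijective f hf)]
    simp
  · intro i j
    change T.Adj (z (i + 1)) (z (j + 1)) ↔ _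
    refine ⟨fun h => ?_, ?_⟩
    · have h1 := hT.dist_eq_dist_add_one_of_adj p h
      rw [hdist _ (by omega), hdist _ (by omega)] at h1
      omega
    · rintro (h | h)
      · rw [← h]
        exact hadj _ (by omega)
      · rw [← h]
        exact (hadj _ (by omega)).symm
  · intro i a
    change T.Adj (z (i + 1)) (e₁ a) ↔ _
    have ha := (e₁ a).2
    refine ⟨fun h => ?_, fun h => by rw [h]; exact ha.2⟩
    have := hinj _ (by omega) _ (by omega) (eq_of_mem_pendants ha.1 h.symm ha.2.symm)
    omega
  · intro i a
    change T.Adj (z (i + 1)) (e₂ a) ↔ _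
    have ha := (e₂ a).2
    refine ⟨fun h => ?_, fun h => by rw [h]; exact ha.2⟩
    exact hinj _ (by omega) _ (by omega) (eq_of_mem_pendants ha.1 h.symm ha.2.symm)
  · intro a b h
    change T.Adj (f (.inr a)) (f (.inr b)) at h
    rcases hleaf _ (hfr a) with h1 | h1
    · have := eq_of_mem_pendants (hfr a) h h1.symm
      exact hznp 1 (by omega) (by omega) (this ▸ hfr b)
    · have := eq_of_mem_pendants (hfr a) h h1.symm
      exact hznp (m - 1) (by omega) (by omega) (this ▸ hfr b)

end DistLap

end

theorem theorem2p6 (n k : ℕ) (hk : 2 ≤ k) (hkn : k + 2 ≤ n) :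
    (∃ G ∈ DistLap.pendantClass n k,
      ∀ H ∈ DistLap.pendantClass n k, DistLap.distLapRadius H ≤ DistLap.distLapRadius G) ∧
    ∀ G ∈ DistLap.pendantClass n k,
      (∀ H ∈ DistLap.pendantClass n k, DistLap.distLapRadius H ≤ DistLap.distLapRadius G) →
      G ∈ DistLap.broomClass n k := by
  have : Nontrivial (Fin n) := Fin.nontrivial_iff_two_le.2 (by omega)
  obtain ⟨M, hM⟩ := DistLap.exists_isExtremal (V := Fin n) (k := k)
    (by rw [Fintype.card_fin]; omega)
  have hMmem : M ∈ DistLap.pendantClass n k := ⟨hM.connected, hM.numPendant_eq hk⟩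
  refine ⟨⟨M, hMmem, fun H hH => hM.radius_le H hH.1 hH.2.ge⟩, fun G hG hmax => ?_⟩
  -- The maximum over at least k pendant vertices is attained at M, which has exactly k, so
  -- maximality in the smaller class implies it in the larger.
  have hext : DistLap.IsExtremal k G :=
    ⟨hG.1, hG.2.ge, fun H hH hkH => (hM.radius_le H hH hkH).trans (hmax M hMmem)⟩
  have ht := hext.isTree hk
  have hcard : (DistLap.pendants G).ncard = k := hG.2
  have hne : (DistLap.pendants G).Nonempty := Set.nonempty_of_ncard_ne_zero (by omega)
  have hcompl : 1 < (DistLap.pendants G)ᶜ.ncard := by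
    rw [Set.ncard_compl, hcard, Nat.card_eq_fintype_card, Fintype.card_fin]
    omega
  obtain ⟨x, y, hx, hy, hxy⟩ := (Set.one_lt_ncard_iff (Set.toFinite _)).1 hcompl
  obtain ⟨l, t₁, t₂, hl, h₁, h₂, hsum, hln, hiso⟩ := DistLap.exists_iso_doubleBroom ht
    (fun c b w₁ w₂ a₁ a₂ ne n₁ n₂ hb => hext.eq_or_eq_of_adj ht a₁ a₂ ne n₁ n₂ hb) hne hx hy hxy
  rw [hG.2] at hsum hln
  rw [Nat.card_eq_fintype_card, Fintype.card_fin] at hln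
  exact ⟨l, t₁, t₂, hl, h₁, h₂, hsum, hln, hiso⟩
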